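/- **Proposition.** Work in $\mathbb{Q}\cup\{\tfrac10\}$, where $\tfrac10+r=\tfrac10$ and $r/\tfrac10=0$ for $r\in\mathbb{Q}$, and $1/0=\tfrac10$. For integers $x_0,\dots,x_t$ define the continued fraction recursively by $[x_0]=x_0$ and $[x_0;x_1,\dots,x_t]=x_0+\frac{1}{[x_1;\dots,x_t]}$ for $t>0$. By surgery on the Hopf link with coefficients $(\rho_1,\rho_2)$, $\rho_i\in\mathbb{Q}\cup\{\tfrac10\}$, we mean rational (Dehn) surgery in $\mathbb{S}^3$ on the link of two unknots linked once, with coefficient $\rho_i$ on the $i$-th component. Let $n,m\ge 0$, let $a_0,\dots,a_n,b_0,\dots,b_m$ be integers, and let $$\frac pq=[a_0;a_1,\dots,a_n],\qquad \frac rs=[b_0;b_1,\dots,b_{m-1},b_m+1]$$ (for $m=0$ this reads $\frac rs=[b_0+1]$). 1. For every $l\ge 1$ and all integers $k_1,\dots,k_l$, surgery on the Hopf link with coefficients $\left(\frac pq,\frac rs\right)$ gives the same oriented 3-manifold (up to orientation-preserving homeomorphism) as surgery on the Hopf link with coefficients $\left(\frac cd,\frac ef\right)$, where $$\frac cd=[k_l;\dots,k_1,a_0,\dots,a_n]^{(-1)^l},\qquad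 \frac ef=[k_l;\dots,k_2,k_1+b_0,b_1,\dots,b_{m-1},b_m+1]^{(-1)^{l+1}}$$ (for $m=0$ the second bracket is $[k_l;\dots,k_2,k_1+b_0+1]$). 2. In particular, surgery on the Hopf link with coefficients $\left(\frac pq,\frac rs\right)$ gives the same oriented 3-manifold as surgery on the Hopf link with coefficients $\left(\frac ab,1\right)$, where $$\frac ab=[-b_m;\dots,-b_0,a_0,\dots,a_n]^{(-1)^{m+1}}.$$ -/

import Mathlib

open scoped Topology

noncomputable section

namespace HopfSurgery

/-! ### Extended rational numbers and continued fractions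

Surgery coefficients live in `ℚ ∪ {1/0}`, modelled by `OnePoint ℚ`; the point `1/0` is `OnePoint.infty`. -/

/-- Addition of a rational number to an extended rational number, with `r + 1/0 = 1/0`. -/
def addExt (r : ℚ) : OnePoint ℚ → OnePoint ℚ
  | none => none
  | some x => ((r + x : ℚ) : OnePoint ℚ)

/-- Inversion of extended rational numbers, with `1 / (1/0) = 0` and `1 / 0 = 1/0`. -/
def invExt : OnePoint ℚ → OnePoint ℚ
  | none => ((0 : ℚ) : OnePoint ℚ)
  | some x => if x = 0 then OnePoint.infty else ((x⁻¹ : ℚ) : OnePoint ℚ)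

/-- The power `x ^ ((-1) ^ n)`: it is `x` for even `n`, and `1 / x` for odd `n`. -/
def powSign (x : OnePoint ℚ) (n : ℕ) : OnePoint ℚ :=
  if Even n then x else invExt x

/-- The value of the continued fraction `[a₀; a₁, …, aₗ]`. The empty list is not a continued fraction,
its value is a placeholder. -/
def contFrac : List ℤ → OnePoint ℚ
  | [] => OnePoint.infty
  | [a] => ((a : ℚ) : OnePoint ℚ)
  | a :: a' :: l => addExt a (invExt (contFrac (a' :: l)))

/-! ### Rational surgery on a link in the 3-sphere -/

/-- The 3-sphere `{(z, w) ∈ ℂ² : |z|² + |w|² = 1}`, with the subspace topology. -/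
abbrev S3 : Type := {x : ℂ × ℂ // ‖x.1‖ ^ 2 + ‖x.2‖ ^ 2 = 1}

/-- The solid torus `S¹ × D²`. -/
abbrev SolidTorus : Type := Circle × Metric.closedBall (0 : ℂ) 1

/-- The inclusion of the boundary torus `S¹ × S¹` in the solid torus. -/
def boundary (x : Circle × Circle) : SolidTorus :=
  (x.1, ⟨(x.2 : ℂ), mem_closedBall_zero_iff.2 (Circle.norm_coe x.2).le⟩)

/-- A linear homeomorphism of the boundary torus `S¹ × S¹` of a solid torus, where the first factor is
the longitude direction `λ` and the second factor the meridian direction `μ`. It takes the meridian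
`{1} × S¹` to a curve in the class `p μ + q λ`, and the longitude `S¹ × {1}` to a curve in the class
`x μ + y λ`; the determinant is `±1`. -/
structure Gluing where
  /-- the meridian is sent to `p μ + q λ` -/
  p : ℤ
  /-- the meridian is sent to `p μ + q λ` -/
  q : ℤ
  /-- the longitude is sent to `x μ + y λ` -/
  x : ℤ
  /-- the longitude is sent to `x μ + y λ` -/
  y : ℤ
  isUnit_det : IsUnit (p * y - q * x)

/-- The map of the torus given by a gluing. -/
def Gluing.toFun (A : Gluing) (x : Circle × Circle) : Circle × Circle :=
  (x.1 ^ A.y * x.2 ^ A.q, x.1 ^ A.x * x.2 ^ A.p)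

/-- The surgery coefficient `p / q ∈ ℚ ∪ {1/0}` of a gluing that takes the meridian to `p μ + q λ`. -/
def Gluing.coeff (A : Gluing) : OnePoint ℚ :=
  if A.q = 0 then OnePoint.infty else (((A.p : ℚ) / (A.q : ℚ) : ℚ) : OnePoint ℚ)

/-- Every extended rational number is the coefficient of some gluing. -/
theorem exists_gluing (r : OnePoint ℚ) : ∃ A : Gluing, A.coeff = r := by
  induction r using OnePoint.rec with
  | infty => exact ⟨⟨1, 0, 0, 1, by simp⟩, by simp [Gluing.coeff]⟩
  | coe r =>
    have h : IsCoprime r.num (r.den : ℤ) := Rat.isCoprime_num_den r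
    obtain ⟨s, t, hst⟩ := h
    refine ⟨⟨r.num, r.den, -t, s, ?_⟩, ?_⟩
    · have : r.num * s - (r.den : ℤ) * -t = 1 := by linarith
      rw [this]
      exact isUnit_one
    · simp [Gluing.coeff, Rat.num_div_den]

/-- The exterior of a link with tubular neighbourhoods `T i` of its components: the complement in the
3-sphere of the open solid tori. -/
abbrev Exterior {ι : Type} (T : ι → SolidTorus → S3) : Type :=
  {e : S3 // ∀ (i : ι) (x : SolidTorus), ‖(x.2 : ℂ)‖ < 1 → T i x ≠ e}

/-- The identifications made in a surgery: the point `x` of the boundary of the `i`-th new solid torus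
is glued to the point `T i (A i x)` on the boundary of the `i`-th tube. -/
inductive GlueRel {ι : Type} (T : ι → SolidTorus → S3) (A : ι → Gluing) :
    Exterior T ⊕ (Σ _ : ι, SolidTorus) → Exterior T ⊕ (Σ _ : ι, SolidTorus) → Prop
  | glue (i : ι) (x : Circle × Circle) (e : Exterior T) (h : e.1 = T i (boundary ((A i).toFun x))) :
      GlueRel T A (Sum.inr ⟨i, boundary x⟩) (Sum.inl e)

/-- Rational (Dehn) surgery on a link in the 3-sphere. The components of the link have the disjoint
tubular neighbourhoods `T i : S¹ × D² → S³`, for which the longitude `S¹ × {1}` has linking number `0`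
with the core `S¹ × {0}`, and the meridian `{1} × S¹` linking number `+1`. The interiors of these
tubes are removed, and for each `i` a new solid torus is glued in along `A i`, so that its meridian
goes to the curve `p μ + q λ`: the surgery coefficient of the `i`-th component is `p / q`. -/
def Surgery {ι : Type} (T : ι → SolidTorus → S3) (A : ι → Gluing) : Type :=
  Quot (GlueRel T A)

instance {ι : Type} (T : ι → SolidTorus → S3) (A : ι → Gluing) : TopologicalSpace (Surgery T A) :=
  inferInstanceAs (TopologicalSpace (Quot (GlueRel T A)))

/-- The map of the link exterior to the manifold obtained by surgery. -/
def Surgery.ofExterior {ι : Type} (T : ι → SolidTorus → S3) (A : ι → Gluing) (e : Exterior T) :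
    Surgery T A :=
  Quot.mk _ (Sum.inl e)

/-! ### The Hopf link -/

theorem tube_norm (u : Circle) (v : Metric.closedBall (0 : ℂ) 1) :
    ‖((√(1 - ‖(v : ℂ)‖ ^ 2 / 4) : ℝ) : ℂ) * (u : ℂ)‖ ^ 2 + ‖(v : ℂ) / 2‖ ^ 2 = 1 := by
  have hv : ‖(v : ℂ)‖ ≤ 1 := mem_closedBall_zero_iff.1 v.2
  have h0 : (0 : ℝ) ≤ 1 - ‖(v : ℂ)‖ ^ 2 / 4 := by nlinarith [norm_nonneg (v : ℂ)]
  rw [norm_mul, Circle.norm_coe, mul_one, Complex.norm_real, Real.norm_eq_abs, sq_abs,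
    Real.sq_sqrt h0, norm_div, div_pow]
  norm_num

/-- The Hopf link `{w = 0} ∪ {z = 0}` in the 3-sphere, with tubular neighbourhoods `|w| ≤ 1/2` and
`|z| ≤ 1/2`. The cores are oriented as `(u, 0)` and `(0, u)`, `u ∈ S¹`. For the orientation of the
sphere as the boundary of the ball in `ℂ²`, the two cores have linking number `1`. The longitude
`(c u, 1/2)` of the first core bounds the disc `{(ζ, √(1 - |ζ|²)) : |ζ| ≤ c}`, which is disjoint
from the core, and the meridian `(c, v/2)` is parallel to the second core, so it has linking number
`+1` with the first core; likewise for the second tube. -/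
def hopfTube : Fin 2 → SolidTorus → S3
  | 0, x => ⟨(((√(1 - ‖(x.2 : ℂ)‖ ^ 2 / 4) : ℝ) : ℂ) * (x.1 : ℂ), (x.2 : ℂ) / 2), tube_norm x.1 x.2⟩
  | 1, x => ⟨((x.2 : ℂ) / 2, ((√(1 - ‖(x.2 : ℂ)‖ ^ 2 / 4) : ℝ) : ℂ) * (x.1 : ℂ)), by
      rw [add_comm]; exact tube_norm x.1 x.2⟩

theorem cover_norm (x : Fin 3 → ℝ) :
    ‖(((√(1 + Real.exp (x 2) ^ 2))⁻¹ : ℝ) : ℂ) * (Circle.exp (x 0) : ℂ)‖ ^ 2 +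
      ‖((Real.exp (x 2) * (√(1 + Real.exp (x 2) ^ 2))⁻¹ : ℝ) : ℂ) * (Circle.exp (x 1) : ℂ)‖ ^ 2
      = 1 := by
  have h0 : (0 : ℝ) < 1 + Real.exp (x 2) ^ 2 := by positivity
  rw [norm_mul, norm_mul, Circle.norm_coe, Circle.norm_coe, mul_one, mul_one, Complex.norm_real,
    Complex.norm_real, Real.norm_eq_abs, Real.norm_eq_abs, sq_abs, sq_abs, mul_pow, inv_pow,
    Real.sq_sqrt h0.le]
  field_simp

/-- The universal covering `ℝ³ → S³ ∖ {z w = 0}` of the complement of the Hopf link,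
`(α, β, s) ↦ (e^{iα}, e^{s + iβ}) / √(1 + e^{2s})`. Its local inverses are an oriented atlas of that
complement. -/
def hopfCover (x : Fin 3 → ℝ) : S3 :=
  ⟨((((√(1 + Real.exp (x 2) ^ 2))⁻¹ : ℝ) : ℂ) * (Circle.exp (x 0) : ℂ),
    ((Real.exp (x 2) * (√(1 + Real.exp (x 2) ^ 2))⁻¹ : ℝ) : ℂ) * (Circle.exp (x 1) : ℂ)),
    cover_norm x⟩

/-- Existence of an orientation-preserving homeomorphism between two manifolds obtained by surgery on
the Hopf link, both oriented by the orientation of the link exterior in the 3-sphere. As these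
manifolds are connected, a homeomorphism preserves the orientation as soon as it does so near one
point. This is expressed by a homeomorphism `h` which, near some point of the exterior, is given in
the oriented coordinates by a map `g` with positive Jacobian determinant at that point. (Between
smooth connected 3-manifolds a homeomorphism that preserves orientation is isotopic to a
diffeomorphism that does so and has this form, so this condition on `h` does not restrict the relation.) -/
def OrientedHomeomorphic (A A' : Fin 2 → Gluing) : Prop :=
  ∃ h : Surgery hopfTube A ≃ₜ Surgery hopfTube A',
    ∃ (x₀ : Fin 3 → ℝ) (g : (Fin 3 → ℝ) → (Fin 3 → ℝ)) (g' : (Fin 3 → ℝ) →L[ℝ] (Fin 3 → ℝ)),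
      HasFDerivAt g g' x₀ ∧ 0 < g'.det ∧
      ∀ᶠ x in 𝓝 x₀, ∃ e e' : Exterior hopfTube,
        e.1 = hopfCover x ∧ e'.1 = hopfCover (g x) ∧
        h (Surgery.ofExterior hopfTube A e) = Surgery.ofExterior hopfTube A' e'

/-- Surgery on the Hopf link with coefficients `(r₁, r₂)` and with coefficients `(r₁', r₂')` gives the
same oriented manifold, whichever gluings with these coefficients are used. -/
def SameSurgery (r₁ r₂ r₁' r₂' : OnePoint ℚ) : Prop :=
  ∀ A A' : Fin 2 → Gluing, (A 0).coeff = r₁ → (A 1).coeff = r₂ →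
    (A' 0).coeff = r₁' → (A' 1).coeff = r₂' → OrientedHomeomorphic A A'

end HopfSurgery

end

noncomputable section

namespace HopfSurgery

/-! The exterior of the Hopf link is a torus times an interval: the two angles range over the torus,
the radii over the interval. So every `M` in SL₂(ℤ), acting on the angles, is an
orientation-preserving homeomorphism of the exterior. It acts on slopes as `M` at one end and as
`M.swap` at the other, because the meridian of each component is the longitude of the other.

A filling depends only on the slope of its meridian (`exists_torusHomeo`), so the homeomorphism
extends over the new solid tori once it carries slopes to slopes (`orientedHomeomorphic_of_coeff`).
This reduces the theorem to the arithmetic of `SlopesEquiv`.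

The shear λ ↦ λ + kμ takes (r₁, r₂) to (k + r₁, 1/(k + 1/r₂)), and its swap does the same with the
components exchanged. Using the two kinds alternately prepends integers to both continued fractions,
with opposite exponents (`slopesEquiv_contFrac`). With kᵢ = -bᵢ₋₁ the second fraction telescopes to
1 (`contFrac_cancel`), which gives the second part. -/

/-! ### The group of gluings -/

/-- Composition of linear homeomorphisms of the torus. -/
def Gluing.comp (M A : Gluing) : Gluing where
  p := M.x * A.q + M.p * A.p
  q := M.y * A.q + M.q * A.p
  x := M.x * A.y + M.p * A.x
  y := M.y * A.y + M.q * A.x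
  isUnit_det := by
    have h := M.isUnit_det.mul A.isUnit_det
    convert h using 1
    ring

/-- Conjugation of a linear homeomorphism of the torus by the exchange of the two factors. -/
def Gluing.swap (M : Gluing) : Gluing where
  p := M.y
  q := M.x
  x := M.q
  y := M.p
  isUnit_det := by
    convert M.isUnit_det using 1
    ring

/-- The inverse of a linear homeomorphism of the torus. -/
def Gluing.inv (M : Gluing) : Gluing where
  p := (M.p * M.y - M.q * M.x) * M.y
  q := -((M.p * M.y - M.q * M.x) * M.q)
  x := -((M.p * M.y - M.q * M.x) * M.x)
  y := (M.p * M.y - M.q * M.x) * M.p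
  isUnit_det := by
    convert (M.isUnit_det.mul M.isUnit_det).mul M.isUnit_det using 1
    ring

theorem Gluing.comp_assoc (M N A : Gluing) : (M.comp N).comp A = M.comp (N.comp A) := by
  simp only [Gluing.comp, Gluing.mk.injEq]
  refine ⟨?_, ?_, ?_, ?_⟩ <;> ring

theorem Gluing.swap_comp (M N : Gluing) : (M.comp N).swap = M.swap.comp N.swap := by
  simp only [Gluing.comp, Gluing.swap, Gluing.mk.injEq]
  refine ⟨?_, ?_, ?_, ?_⟩ <;> ring

/-- A determinant ±1 is its own reciprocal, which is why `Gluing.inv` is the adjugate multiplied,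
not divided, by the determinant. -/
theorem Gluing.det_mul_self (M : Gluing) :
    (M.p * M.y - M.q * M.x) * (M.p * M.y - M.q * M.x) = 1 :=
  Int.isUnit_mul_self M.isUnit_det

theorem Gluing.toFun_comp (M A : Gluing) (x : Circle × Circle) :
    (M.comp A).toFun x = M.toFun (A.toFun x) := by
  simp only [Gluing.toFun, Gluing.comp, Prod.mk.injEq, mul_zpow, ← zpow_mul, zpow_add]
  constructor <;>
  · rw [mul_comm A.y, mul_comm A.q, mul_comm A.x, mul_comm A.p]
    ac_rfl

theorem Gluing.toFun_id {M : Gluing} (hp : M.p = 1) (hq : M.q = 0) (hx : M.x = 0) (hy : M.y = 1)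
    (x : Circle × Circle) : M.toFun x = x := by
  simp [Gluing.toFun, hp, hq, hx, hy]

theorem Gluing.toFun_inv_toFun (M : Gluing) (x : Circle × Circle) :
    M.inv.toFun (M.toFun x) = x := by
  have h := M.det_mul_self
  rw [← Gluing.toFun_comp]
  apply Gluing.toFun_id <;> simp only [Gluing.comp, Gluing.inv] <;>
    first | ring1 | linear_combination h

theorem Gluing.toFun_toFun_inv (M : Gluing) (x : Circle × Circle) :
    M.toFun (M.inv.toFun x) = x := by
  have h := M.det_mul_self
  rw [← Gluing.toFun_comp]
  apply Gluing.toFun_id <;> simp only [Gluing.comp, Gluing.inv] <;>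
    first | ring1 | linear_combination h

theorem Gluing.continuous_toFun (M : Gluing) : Continuous M.toFun := by
  unfold Gluing.toFun
  fun_prop

/-! ### Coefficients of gluings -/

theorem Gluing.p_ne_zero (A : Gluing) (h : A.q = 0) : A.p ≠ 0 := by
  intro hp
  have := A.isUnit_det
  simp [h, hp] at this

/-- Cross-multiplication remains valid at 1/0 because p and q cannot both vanish when the
determinant is a unit. -/
theorem Gluing.coeff_eq_iff (A B : Gluing) : A.coeff = B.coeff ↔ A.p * B.q = A.q * B.p := by
  unfold Gluing.coeff
  split_ifs with hA hB hB
  · simp [hA, hB]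
  · simp [hA, hB, A.p_ne_zero hA]
  · simp [hA, hB, B.p_ne_zero hB]
  · have hA' : (A.q : ℚ) ≠ 0 := by exact_mod_cast hA
    have hB' : (B.q : ℚ) ≠ 0 := by exact_mod_cast hB
    rw [OnePoint.coe_eq_coe, div_eq_div_iff hA' hB', mul_comm (B.p : ℚ)]
    exact_mod_cast Iff.rfl

/-- A linear homeomorphism of the torus that takes the slope `r` to the slope `r'`. -/
def MapsSlope (M : Gluing) (r r' : OnePoint ℚ) : Prop :=
  ∀ A : Gluing, A.coeff = r → (M.comp A).coeff = r'

theorem MapsSlope.comp {M N : Gluing} {r r' r'' : OnePoint ℚ} (hN : MapsSlope N r' r'')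
    (hM : MapsSlope M r r') : MapsSlope (N.comp M) r r'' := by
  intro A hA
  rw [Gluing.comp_assoc]
  exact hN _ (hM A hA)

/-- The map adding `k` meridians to the longitude. -/
def twist (k : ℤ) : Gluing := ⟨1, 0, k, 1, by simp⟩

theorem mapsSlope_twist (k : ℤ) (r : OnePoint ℚ) : MapsSlope (twist k) r (addExt k r) := by
  rintro A rfl
  simp only [Gluing.coeff, Gluing.comp, twist]
  by_cases h : A.q = 0
  · simp only [h]
    simp
    rfl
  · have h' : (A.q : ℚ) ≠ 0 := by exact_mod_cast h
    simp only [h, one_mul, zero_mul, add_zero, if_false]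
    change _ = ((_ : ℚ) : OnePoint ℚ)
    rw [OnePoint.coe_eq_coe]
    push_cast
    field_simp

/-- The exchange of the two factors of the torus. -/
def flip : Gluing := ⟨0, 1, 1, 0, by simp⟩

theorem invExt_infty : invExt OnePoint.infty = ((0 : ℚ) : OnePoint ℚ) := rfl

theorem invExt_coe (r : ℚ) :
    invExt (r : OnePoint ℚ) = if r = 0 then OnePoint.infty else ((r⁻¹ : ℚ) : OnePoint ℚ) := rfl

theorem mapsSlope_flip (r : OnePoint ℚ) : MapsSlope flip r (invExt r) := by
  rintro A rfl
  simp only [Gluing.coeff, Gluing.comp, flip, one_mul, zero_mul, add_zero, zero_add]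
  by_cases hq : A.q = 0
  · simp [hq, A.p_ne_zero hq, invExt_infty]
  · by_cases hp : A.p = 0
    · simp [hq, hp, invExt_coe]
    · simp [hq, hp, invExt_coe]

theorem mapsSlope_swap_twist (k : ℤ) (r : OnePoint ℚ) :
    MapsSlope (twist k).swap r (invExt (addExt k (invExt r))) := by
  -- `flip` reverses orientation, but it occurs twice here, so the determinant stays 1.
  have h : (twist k).swap = flip.comp ((twist k).comp flip) := by
    simp [twist, flip, Gluing.swap, Gluing.comp]
  rw [h]
  exact (mapsSlope_flip _).comp ((mapsSlope_twist k _).comp (mapsSlope_flip r))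

/-- Two pairs of slopes of the Hopf link that correspond under an orientation-preserving linear
homeomorphism of the exterior. -/
def SlopesEquiv (r₁ r₂ r₁' r₂' : OnePoint ℚ) : Prop :=
  ∃ M : Gluing, M.p * M.y - M.q * M.x = 1 ∧ MapsSlope M r₁ r₁' ∧ MapsSlope M.swap r₂ r₂'

theorem SlopesEquiv.trans {r₁ r₂ s₁ s₂ t₁ t₂ : OnePoint ℚ} (h : SlopesEquiv r₁ r₂ s₁ s₂)
    (h' : SlopesEquiv s₁ s₂ t₁ t₂) : SlopesEquiv r₁ r₂ t₁ t₂ := by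
  obtain ⟨M, hM, h₁, h₂⟩ := h
  obtain ⟨N, hN, h₁', h₂'⟩ := h'
  refine ⟨N.comp M, ?_, h₁'.comp h₁, ?_⟩
  · simp only [Gluing.comp]
    linear_combination (M.p * M.y - M.q * M.x) * hN + hM
  · rw [Gluing.swap_comp]
    exact h₂'.comp h₂

theorem slopesEquiv_twist (k : ℤ) (r₁ r₂ : OnePoint ℚ) :
    SlopesEquiv r₁ r₂ (addExt k r₁) (invExt (addExt k (invExt r₂))) :=
  ⟨twist k, by simp [twist], mapsSlope_twist k r₁, mapsSlope_swap_twist k r₂⟩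

theorem slopesEquiv_swap_twist (k : ℤ) (r₁ r₂ : OnePoint ℚ) :
    SlopesEquiv r₁ r₂ (invExt (addExt k (invExt r₁))) (addExt k r₂) :=
  ⟨(twist k).swap, by simp [twist, Gluing.swap], mapsSlope_swap_twist k r₁, mapsSlope_twist k r₂⟩

/-! ### Continued fractions -/

theorem invExt_invExt (r : OnePoint ℚ) : invExt (invExt r) = r := by
  induction r using OnePoint.rec with
  | infty => simp [invExt_infty, invExt_coe]
  | coe r =>
    by_cases h : r = 0
    · simp [h, invExt_infty, invExt_coe]
    · simp [h, invExt_coe]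

theorem addExt_zero (r : OnePoint ℚ) : addExt 0 r = r := by
  induction r using OnePoint.rec with
  | infty => rfl
  | coe r => exact congrArg _ (zero_add r)

theorem addExt_addExt (a b : ℚ) (r : OnePoint ℚ) : addExt a (addExt b r) = addExt (a + b) r := by
  induction r using OnePoint.rec with
  | infty => rfl
  | coe r => exact congrArg _ (add_assoc a b r).symm

theorem contFrac_cons (k : ℤ) {l : List ℤ} (hl : l ≠ []) :
    contFrac (k :: l) = addExt k (invExt (contFrac l)) := by
  cases l with
  | nil => exact absurd rfl hl
  | cons a l => rfl

theorem contFrac_modifyHead_add (k : ℤ) {l : List ℤ} (hl : l ≠ []) :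
    contFrac (l.modifyHead (fun t => k + t)) = addExt k (contFrac l) := by
  match l with
  | [] => exact absurd rfl hl
  | [a] =>
    change (((k + a : ℤ) : ℚ) : OnePoint ℚ) = ((k + a : ℚ) : OnePoint ℚ)
    push_cast
    rfl
  | a :: b :: l =>
    change addExt ((k + a : ℤ) : ℚ) _ = addExt k (addExt a _)
    rw [addExt_addExt]
    push_cast
    rfl

/-- A nonempty tail enters the recursion only through its value. -/
theorem contFrac_append_congr (l : List ℤ) {l₁ l₂ : List ℤ} (h₁ : l₁ ≠ []) (h₂ : l₂ ≠ [])
    (h : contFrac l₁ = contFrac l₂) : contFrac (l ++ l₁) = contFrac (l ++ l₂) := by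
  induction l with
  | nil => exact h
  | cons a l ih =>
    rw [List.cons_append, List.cons_append, contFrac_cons _ (by simp [h₁]),
      contFrac_cons _ (by simp [h₂]), ih]

theorem modifyLast_add_one_ne_nil {b : List ℤ} (hb : b ≠ []) :
    b.modifyLast (fun t => t + 1) ≠ [] := by
  rw [← List.dropLast_append_getLast hb, List.modifyLast_concat]
  simp

/-- The junction creates an entry -b + b = 0, and [-c; 0, x] = -c + x merges its neighbours into -c
+ c, the next zero. At the last entry the extra 1 survives: -b + (b + 1) = 1. -/
theorem contFrac_cancel (b : ℤ) (l : List ℤ) :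
    contFrac ((l.map (fun t => -t)).reverse ++
      ((b :: l).modifyLast (fun t => t + 1)).modifyHead (fun t => -b + t)) = ((1 : ℚ) : OnePoint ℚ) := by
  induction l generalizing b with
  | nil =>
    change (((-b + (b + 1) : ℤ) : ℚ) : OnePoint ℚ) = _
    simp
  | cons c l ih =>
    have hne : (c :: l).modifyLast (fun t => t + 1) ≠ [] := modifyLast_add_one_ne_nil (by simp)
    have hcons : (b :: c :: l).modifyLast (fun t => t + 1) =
        b :: (c :: l).modifyLast (fun t => t + 1) :=
      List.modifyLast_append_of_right_ne_nil _ [b] (c :: l) (by simp)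
    rw [← ih c, hcons, List.modifyHead_cons, List.map_cons, List.reverse_cons, List.append_assoc]
    apply contFrac_append_congr
    · simp
    · simpa using hne
    · rw [List.singleton_append, contFrac_cons _ (by simp), contFrac_cons _ hne,
        contFrac_modifyHead_add _ hne, neg_add_cancel, Int.cast_zero, addExt_zero, invExt_invExt]

/-! ### Alternating twists and continued fractions. -/

theorem powSign_succ (r : OnePoint ℚ) (n : ℕ) : powSign r (n + 1) = invExt (powSign r n) := by
  by_cases h : Even n <;> simp [powSign, Nat.even_add_one, h, invExt_invExt]

theorem powSign_one (n : ℕ) : powSign ((1 : ℚ) : OnePoint ℚ) n = ((1 : ℚ) : OnePoint ℚ) := by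
  unfold powSign
  split_ifs
  · rfl
  · simp [invExt_coe]

/-- The exponents of the two slopes are opposite, so a single twist adds `k` to both reciprocals `1
/ r₁` and `1 / r₂`. The parity of `n` decides which of the two kinds of twist does this. -/
theorem slopesEquiv_step (k : ℤ) (r₁ r₂ : OnePoint ℚ) (n : ℕ) :
    SlopesEquiv (powSign r₁ n) (powSign r₂ (n + 1))
      (powSign (addExt k (invExt r₁)) (n + 1)) (powSign (addExt k (invExt r₂)) (n + 2)) := by
  rw [powSign_succ _ (n + 1), powSign_succ r₂, powSign_succ (addExt k (invExt r₁)),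
    powSign_succ (addExt k (invExt r₂)), invExt_invExt]
  unfold powSign
  split_ifs
  · exact slopesEquiv_swap_twist k r₁ (invExt r₂)
  · rw [invExt_invExt, invExt_invExt]
    exact slopesEquiv_twist k (invExt r₁) r₂

theorem slopesEquiv_contFrac {a b : List ℤ} (ha : a ≠ []) (hb : b ≠ []) (k : ℤ) (ks : List ℤ) :
    SlopesEquiv (contFrac a) (contFrac b)
      (powSign (contFrac ((k :: ks).reverse ++ a)) (ks.length + 1))
      (powSign (contFrac (ks.reverse ++ b.modifyHead (fun t => k + t))) (ks.length + 2)) := by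
  -- The newest integer comes first in the reversed list, so the induction adds entries at the end
  -- of `ks`.
  induction ks using List.reverseRecOn with
  | nil =>
    -- The second slope enters as the reciprocal of a reciprocal, so `k` is added to it directly:
    -- this is why k₁ merges with b₀ instead of becoming a new entry.
    have := slopesEquiv_step k (contFrac a) (invExt (contFrac b)) 0
    simpa [powSign, invExt_invExt, contFrac_cons _ ha, contFrac_modifyHead_add _ hb] using this
  | append_singleton ks c ih =>
    refine ih.trans ?_
    have h₁ : (k :: (ks ++ [c])).reverse ++ a = c :: ((k :: ks).reverse ++ a) := by simp
    have h₂ : (ks ++ [c]).reverse ++ b.modifyHead (fun t => k + t) =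
        c :: (ks.reverse ++ b.modifyHead (fun t => k + t)) := by simp
    rw [h₁, h₂, contFrac_cons _ (by simp), contFrac_cons _ (by simp [hb]), List.length_append]
    exact slopesEquiv_step c _ _ (ks.length + 1)

/-! ### Linear homeomorphisms of the exterior of the Hopf link -/

/-- The phase of a nonzero complex number. -/
def phase (z : ℂ) (hz : z ≠ 0) : Circle :=
  ⟨z / ‖z‖, mem_sphere_zero_iff_norm.2 (by simp [hz])⟩

theorem norm_mul_phase (z : ℂ) (hz : z ≠ 0) : (‖z‖ : ℂ) * phase z hz = z := by
  change (‖z‖ : ℂ) * (z / ‖z‖) = z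
  have : (‖z‖ : ℂ) ≠ 0 := by simpa using hz
  field_simp

theorem phase_mul {t : ℝ} (ht : 0 < t) (u : Circle) (h : (t : ℂ) * u ≠ 0) :
    phase ((t : ℂ) * u) h = u := by
  ext
  change (t : ℂ) * u / ‖(t : ℂ) * u‖ = u
  have : (t : ℂ) ≠ 0 := by exact_mod_cast ht.ne'
  simp only [norm_mul, Complex.norm_real, Real.norm_eq_abs, abs_of_pos ht, Circle.norm_coe, mul_one]
  field_simp

/-- The exterior is cut out by conditions on the radii alone, so any change of the angles preserves
it. -/
theorem hopf_exterior_iff (e : S3) :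
    (∀ (i : Fin 2) (x : SolidTorus), ‖(x.2 : ℂ)‖ < 1 → hopfTube i x ≠ e) ↔
      1 / 2 ≤ ‖e.1.1‖ ∧ 1 / 2 ≤ ‖e.1.2‖ := by
  have key : ∀ z w : ℂ, ‖z‖ ^ 2 + ‖w‖ ^ 2 = 1 → ‖w‖ < 1 / 2 →
      ∃ x : SolidTorus, ‖(x.2 : ℂ)‖ < 1 ∧
        ((√(1 - ‖(x.2 : ℂ)‖ ^ 2 / 4) : ℝ) : ℂ) * (x.1 : ℂ) = z ∧ (x.2 : ℂ) / 2 = w := by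
    intro z w h hw
    have hz : z ≠ 0 := by
      rintro rfl
      rw [norm_zero] at h
      nlinarith [norm_nonneg w]
    have h2 : ‖2 * w‖ < 1 := by
      rw [norm_mul, Complex.norm_ofNat]
      linarith
    refine ⟨(phase z hz, ⟨2 * w, mem_closedBall_zero_iff.2 h2.le⟩), h2, ?_, ?_⟩
    · have : √(1 - ‖2 * w‖ ^ 2 / 4) = ‖z‖ := by
        rw [Real.sqrt_eq_iff_mul_self_eq_of_pos]
        · rw [norm_mul, Complex.norm_ofNat]
          linarith
        · exact norm_pos_iff.2 hz
      simp only [this, norm_mul_phase]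
    · simp
  constructor
  · intro h
    constructor
    · by_contra! hlt
      obtain ⟨x, hx, h1, h2⟩ := key e.1.2 e.1.1 (by rw [add_comm]; exact e.2) hlt
      exact h 1 x hx (Subtype.ext (Prod.ext h2 h1))
    · by_contra! hlt
      obtain ⟨x, hx, h1, h2⟩ := key e.1.1 e.1.2 e.2 hlt
      exact h 0 x hx (Subtype.ext (Prod.ext h1 h2))
  · rintro ⟨h1, h2⟩ i x hx rfl
    fin_cases i
    · have : ‖(x.2 : ℂ) / 2‖ < 1 / 2 := by
        rw [norm_div, Complex.norm_ofNat]
        linarith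
      exact absurd h2 (not_le.2 this)
    · have : ‖(x.2 : ℂ) / 2‖ < 1 / 2 := by
        rw [norm_div, Complex.norm_ofNat]
        linarith
      exact absurd h1 (not_le.2 this)

theorem Exterior.fst_ne_zero (e : Exterior hopfTube) : e.1.1.1 ≠ 0 :=
  norm_pos_iff.1 (lt_of_lt_of_le (by norm_num) ((hopf_exterior_iff e.1).1 e.2).1)

theorem Exterior.snd_ne_zero (e : Exterior hopfTube) : e.1.1.2 ≠ 0 :=
  norm_pos_iff.1 (lt_of_lt_of_le (by norm_num) ((hopf_exterior_iff e.1).1 e.2).2)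

/-- The angular coordinates on the exterior of the Hopf link. -/
def angles (e : Exterior hopfTube) : Circle × Circle :=
  (phase e.1.1.1 e.fst_ne_zero, phase e.1.1.2 e.snd_ne_zero)

theorem continuous_angles : Continuous angles := by
  unfold angles phase
  refine Continuous.prodMk ?_ ?_
  · refine Continuous.subtype_mk (Continuous.div ?_ ?_ ?_) _
    · fun_prop
    · fun_prop
    · intro e
      simpa using e.fst_ne_zero
  · refine Continuous.subtype_mk (Continuous.div ?_ ?_ ?_) _
    · fun_prop
    · fun_prop
    · intro e
      simpa using e.snd_ne_zero

/-- The point of the 3-sphere with the same radii as `e`, and the angular coordinates `x`. -/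
def withAngles (e : S3) (x : Circle × Circle) : S3 :=
  ⟨((‖e.1.1‖ : ℂ) * x.1, (‖e.1.2‖ : ℂ) * x.2), by simpa [Circle.norm_coe] using e.2⟩

/-- The linear self-map of the exterior of the Hopf link given by a linear map of the torus. -/
def exteriorMap (M : Gluing) (e : Exterior hopfTube) : Exterior hopfTube :=
  ⟨withAngles e.1 (M.toFun (angles e)), (hopf_exterior_iff _).2 (by
    simpa [withAngles, Circle.norm_coe] using (hopf_exterior_iff e.1).1 e.2)⟩

theorem continuous_exteriorMap (M : Gluing) : Continuous (exteriorMap M) := by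
  have h := M.continuous_toFun.comp continuous_angles
  refine Continuous.subtype_mk (Continuous.subtype_mk (Continuous.prodMk ?_ ?_) _) _
  · exact Continuous.mul (by fun_prop) (continuous_subtype_val.comp (continuous_fst.comp h))
  · exact Continuous.mul (by fun_prop) (continuous_subtype_val.comp (continuous_snd.comp h))

/-- A point of the exterior is determined by its radii and angles; the image under `exteriorMap`
is computed from them. -/
theorem exteriorMap_eq {M : Gluing} {e : Exterior hopfTube} {e' : S3} {t s : ℝ} (ht : 0 < t) (hs : 0 < s)
    {x : Circle × Circle} (h₁ : e.1.1 = ((t : ℂ) * x.1, (s : ℂ) * x.2))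
    (h₂ : e'.1 = ((t : ℂ) * (M.toFun x).1, (s : ℂ) * (M.toFun x).2)) : (exteriorMap M e).1 = e' := by
  obtain ⟨⟨⟨z, w⟩, hzw⟩, he⟩ := e
  simp only [Prod.mk.injEq] at h₁
  obtain ⟨rfl, rfl⟩ := h₁
  refine Subtype.ext ?_
  rw [h₂]
  simp [exteriorMap, withAngles, angles, phase_mul ht, phase_mul hs, abs_of_pos ht, abs_of_pos hs,
    Circle.norm_coe]

theorem exterior_eq (e : Exterior hopfTube) :
    e.1.1 = ((‖e.1.1.1‖ : ℂ) * (angles e).1, (‖e.1.1.2‖ : ℂ) * (angles e).2) :=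
  Prod.ext (norm_mul_phase _ e.fst_ne_zero).symm (norm_mul_phase _ e.snd_ne_zero).symm

theorem exteriorMap_exteriorMap {M N : Gluing} (h : ∀ x, N.toFun (M.toFun x) = x)
    (e : Exterior hopfTube) : exteriorMap N (exteriorMap M e) = e := by
  refine Subtype.ext (exteriorMap_eq (norm_pos_iff.2 e.fst_ne_zero) (norm_pos_iff.2 e.snd_ne_zero)
    (x := M.toFun (angles e)) rfl ?_)
  rw [h]
  exact exterior_eq e

/-- The linear homeomorphism of the exterior of the Hopf link given by an automorphism of the torus. -/
def exteriorHomeo (M : Gluing) : Exterior hopfTube ≃ₜ Exterior hopfTube where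
  toFun := exteriorMap M
  invFun := exteriorMap M.inv
  left_inv := exteriorMap_exteriorMap M.toFun_inv_toFun
  right_inv := exteriorMap_exteriorMap M.toFun_toFun_inv
  continuous_toFun := continuous_exteriorMap M
  continuous_invFun := continuous_exteriorMap M.inv

/-- The automorphism of the boundary torus of the `i`-th tube of the Hopf link given by a linear
homeomorphism of the exterior. -/
def onTube (M : Gluing) (i : Fin 2) : Gluing :=
  if i = 0 then M else M.swap

theorem hopfTube_zero_boundary (x : Circle × Circle) :
    (hopfTube 0 (boundary x)).1 = (((√(1 - 1 / 4) : ℝ) : ℂ) * x.1, ((1 / 2 : ℝ) : ℂ) * x.2) := by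
  simp only [hopfTube, boundary, Circle.norm_coe, one_pow, Prod.mk.injEq, true_and]
  push_cast
  ring

theorem hopfTube_one_boundary (x : Circle × Circle) :
    (hopfTube 1 (boundary x)).1 = (((1 / 2 : ℝ) : ℂ) * x.2, ((√(1 - 1 / 4) : ℝ) : ℂ) * x.1) := by
  simp only [hopfTube, boundary, Circle.norm_coe, one_pow, Prod.mk.injEq, and_true]
  push_cast
  ring

theorem Gluing.toFun_swap (M : Gluing) (x : Circle × Circle) :
    M.toFun x.swap = (M.swap.toFun x).swap := by
  simp [Gluing.toFun, Gluing.swap, mul_comm]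

/-- Both boundary tori have constant radii, so only the angles move. On the second tube the first
angle of the sphere is the meridian angle, whence the conjugation by the swap. -/
theorem exteriorMap_hopfTube (M : Gluing) (i : Fin 2) (x : Circle × Circle)
    {e : Exterior hopfTube} (h : e.1 = hopfTube i (boundary x)) :
    (exteriorMap M e).1 = hopfTube i (boundary ((onTube M i).toFun x)) := by
  have hc : (0 : ℝ) < √(1 - 1 / 4) := Real.sqrt_pos.2 (by norm_num)
  fin_cases i
  · refine exteriorMap_eq hc (by norm_num : (0 : ℝ) < 1 / 2) (x := x) ?_ ?_
    · rw [h]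
      exact hopfTube_zero_boundary x
    · exact hopfTube_zero_boundary _
  · refine exteriorMap_eq (by norm_num : (0 : ℝ) < 1 / 2) hc (x := x.swap) ?_ ?_
    · rw [h]
      exact hopfTube_one_boundary x
    · rw [Gluing.toFun_swap]
      exact hopfTube_one_boundary _

theorem exists_exterior_boundary (i : Fin 2) (x : Circle × Circle) :
    ∃ e : Exterior hopfTube, e.1 = hopfTube i (boundary x) := by
  refine ⟨⟨hopfTube i (boundary x), (hopf_exterior_iff _).2 ?_⟩, rfl⟩
  have hc : (1 / 2 : ℝ) ≤ √(1 - 1 / 4) := Real.le_sqrt_of_sq_le (by norm_num)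
  have hc' : (1 / 2 : ℝ) ≤ |√(1 - 1 / 4)| := hc.trans (le_abs_self _)
  fin_cases i
  · change 1 / 2 ≤ ‖(hopfTube 0 (boundary x)).1.1‖ ∧ 1 / 2 ≤ ‖(hopfTube 0 (boundary x)).1.2‖
    rw [hopfTube_zero_boundary]
    simp only [norm_mul, Circle.norm_coe, mul_one, Complex.norm_real, Real.norm_eq_abs]
    exact ⟨hc', le_abs_self _⟩
  · change 1 / 2 ≤ ‖(hopfTube 1 (boundary x)).1.1‖ ∧ 1 / 2 ≤ ‖(hopfTube 1 (boundary x)).1.2‖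
    rw [hopfTube_one_boundary]
    simp only [norm_mul, Circle.norm_coe, mul_one, Complex.norm_real, Real.norm_eq_abs]
    exact ⟨le_abs_self _, hc'⟩

/-! ### Homeomorphisms of the solid torus -/

/-- The map `v ↦ v` or `v ↦ conj v` of the unit disc. -/
def discFlip (δ : ℤˣ) (v : ℂ) : ℂ := if δ = 1 then v else (starRingEnd ℂ) v

theorem norm_discFlip (δ : ℤˣ) (v : ℂ) : ‖discFlip δ v‖ = ‖v‖ := by
  unfold discFlip
  split_ifs <;> simp

theorem continuous_discFlip (δ : ℤˣ) : Continuous (discFlip δ) := by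
  unfold discFlip
  split_ifs
  · exact continuous_id
  · exact Complex.continuous_conj

theorem discFlip_mul (δ : ℤˣ) (v w : ℂ) : discFlip δ (v * w) = discFlip δ v * discFlip δ w := by
  unfold discFlip
  split_ifs <;> simp

theorem discFlip_discFlip (δ : ℤˣ) (v : ℂ) : discFlip δ (discFlip δ v) = v := by
  unfold discFlip
  split_ifs <;> simp

theorem discFlip_coe (δ : ℤˣ) (v : Circle) : discFlip δ v = (v ^ (δ : ℤ) : Circle) := by
  rcases Int.units_eq_one_or δ with rfl | rfl
  · simp [discFlip]
  · have : (-1 : ℤˣ) ≠ 1 := by decide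
    simp [discFlip, this, ← Circle.coe_inv_eq_conj]

/-- The map `(u, v) ↦ (u ^ ε, u ^ n * v ^ δ)` of the solid torus, where `v ^ (-1)` is the conjugate. -/
def torusMap (ε δ : ℤˣ) (n : ℤ) (x : SolidTorus) : SolidTorus :=
  (x.1 ^ (ε : ℤ), ⟨(x.1 ^ n : Circle) * discFlip δ x.2, by
    simpa [norm_discFlip, Circle.norm_coe] using mem_closedBall_zero_iff.1 x.2.2⟩)

theorem continuous_torusMap (ε δ : ℤˣ) (n : ℤ) : Continuous (torusMap ε δ n) := by
  unfold torusMap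
  refine Continuous.prodMk (by fun_prop) (Continuous.subtype_mk (Continuous.mul ?_ ?_) _)
  · have h : Continuous fun x : SolidTorus => x.1 ^ n := continuous_fst.zpow n
    exact Continuous.comp (g := ((↑) : Circle → ℂ)) continuous_subtype_val h
  · exact (continuous_discFlip δ).comp (continuous_subtype_val.comp continuous_snd)

theorem torusMap_boundary (ε δ : ℤˣ) (n : ℤ) (x : Circle × Circle) :
    torusMap ε δ n (boundary x) = boundary (x.1 ^ (ε : ℤ), x.1 ^ n * x.2 ^ (δ : ℤ)) := by
  refine Prod.ext rfl (Subtype.ext ?_)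
  simp [torusMap, boundary, discFlip_coe]

theorem torusMap_torusMap (ε δ : ℤˣ) {n m : ℤ} (h : ε * m + δ * n = 0) (x : SolidTorus) :
    torusMap ε δ m (torusMap ε δ n x) = x := by
  have hε : (ε : ℤ) * ε = 1 := Int.isUnit_mul_self ε.isUnit
  refine Prod.ext ?_ (Subtype.ext ?_)
  · simp [torusMap, ← zpow_mul, hε]
  · simp only [torusMap, discFlip_mul, discFlip_discFlip, discFlip_coe, ← mul_assoc,
      ← Circle.coe_mul, ← zpow_mul, ← zpow_add]
    rw [mul_comm n, h]
    simp

/-- The homeomorphism `(u, v) ↦ (u ^ ε, u ^ n * v ^ δ)` of the solid torus. -/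
def torusHomeo (ε δ : ℤˣ) (n : ℤ) : SolidTorus ≃ₜ SolidTorus where
  toFun := torusMap ε δ n
  invFun := torusMap ε δ (-(ε * δ * n))
  left_inv := torusMap_torusMap ε δ (by
    have hε : (ε : ℤ) * ε = 1 := Int.isUnit_mul_self ε.isUnit
    linear_combination -(δ * n : ℤ) * hε)
  right_inv := torusMap_torusMap ε δ (by
    have hδ : (δ : ℤ) * δ = 1 := Int.isUnit_mul_self δ.isUnit
    linear_combination -(ε * n : ℤ) * hδ)
  continuous_toFun := continuous_torusMap _ _ _
  continuous_invFun := continuous_torusMap _ _ _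

/-- Two gluings with the same coefficient differ by a homeomorphism of the solid torus. -/
theorem exists_torusHomeo {A B : Gluing} (h : A.coeff = B.coeff) :
    ∃ H : SolidTorus ≃ₜ SolidTorus, ∀ x : Circle × Circle,
      H (boundary x) = boundary (B.inv.toFun (A.toFun x)) := by
  rw [Gluing.coeff_eq_iff] at h
  set C := B.inv.comp A with hC
  -- Equal slopes mean that `C` preserves the meridian up to sign. Its matrix is then triangular
  -- with diagonal entries ±1, and such a map extends over the disc factor.
  have hq : C.q = 0 := by
    simp only [hC, Gluing.comp, Gluing.inv]
    linear_combination -(B.p * B.y - B.q * B.x) * h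
  have hu := C.isUnit_det
  rw [hq, zero_mul, sub_zero] at hu
  obtain ⟨δ, hδ⟩ := isUnit_of_mul_isUnit_left hu
  obtain ⟨ε, hε⟩ := isUnit_of_mul_isUnit_right hu
  refine ⟨torusHomeo ε δ C.x, fun x => ?_⟩
  rw [← Gluing.toFun_comp, ← hC]
  refine (torusMap_boundary ε δ C.x x).trans ?_
  simp [Gluing.toFun, hq, hδ, hε]

/-! ### Homeomorphisms between surgeries -/

/-- The homeomorphism between the pieces of a surgery given by homeomorphisms of the pieces. -/
def piecesHomeo {ι : Type} {T : ι → SolidTorus → S3} (Φ : Exterior T ≃ₜ Exterior T)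
    (H : ι → SolidTorus ≃ₜ SolidTorus) :
    Exterior T ⊕ (Σ _ : ι, SolidTorus) ≃ₜ Exterior T ⊕ (Σ _ : ι, SolidTorus) :=
  Φ.sumCongr
    { toEquiv := Equiv.sigmaCongrRight fun i => (H i).toEquiv
      continuous_toFun := continuous_sigma fun i => continuous_sigmaMk.comp (H i).continuous
      continuous_invFun := continuous_sigma fun i => continuous_sigmaMk.comp (H i).symm.continuous }

/-- A homeomorphism of the pieces that is compatible with the gluings gives a homeomorphism of the
surgeries. -/
def surgeryHomeo {ι : Type} {T : ι → SolidTorus → S3} {A A' : ι → Gluing}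
    (F : Exterior T ⊕ (Σ _ : ι, SolidTorus) ≃ₜ Exterior T ⊕ (Σ _ : ι, SolidTorus))
    (h : ∀ a b, GlueRel T A a b ↔ GlueRel T A' (F a) (F b)) : Surgery T A ≃ₜ Surgery T A' where
  toEquiv := Quot.congr F.toEquiv h
  continuous_toFun := continuous_quot_lift _ (continuous_quot_mk.comp F.continuous)
  continuous_invFun := continuous_quot_lift _ (continuous_quot_mk.comp F.symm.continuous)

/-- By `hH`, each `H i` restricts on the boundary to (A' i)⁻¹ ∘ M ∘ A i, with `M` read on the `i`-th
tube, so the gluing squares commute. The converse holds because every map in the square is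
invertible. -/
theorem glueRel_iff {A A' : Fin 2 → Gluing} (M : Gluing) (H : Fin 2 → SolidTorus ≃ₜ SolidTorus)
    (hH : ∀ i x, H i (boundary x) =
      boundary ((A' i).inv.toFun (((onTube M i).comp (A i)).toFun x)))
    (a b : Exterior hopfTube ⊕ (Σ _ : Fin 2, SolidTorus)) :
    GlueRel hopfTube A a b ↔
      GlueRel hopfTube A' (piecesHomeo (exteriorHomeo M) H a) (piecesHomeo (exteriorHomeo M) H b) := by
  constructor
  · rintro ⟨i, x, e, he⟩
    have := GlueRel.glue (T := hopfTube) (A := A') i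
      ((A' i).inv.toFun (((onTube M i).comp (A i)).toFun x)) (exteriorMap M e) (by
        rw [Gluing.toFun_toFun_inv, Gluing.toFun_comp, exteriorMap_hopfTube M i _ he])
    rw [← hH] at this
    exact this
  · intro h
    generalize ha' : piecesHomeo (exteriorHomeo M) H a = a' at h
    generalize hb' : piecesHomeo (exteriorHomeo M) H b = b' at h
    obtain ⟨i, x', e', he'⟩ := h
    obtain _ | ⟨j, t⟩ := a
    · cases ha'
    obtain e | _ := b
    swap
    · cases hb'
    have hb' : exteriorMap M e = e' := Sum.inl.inj hb'
    obtain ⟨rfl, ht⟩ := Sigma.mk.inj (Sum.inr.inj ha')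
    have ht : H j t = boundary x' := eq_of_heq ht
    set C := (onTube M j).comp (A j) with hC
    set x := C.inv.toFun ((A' j).toFun x') with hx
    have hxx : (A' j).inv.toFun (C.toFun x) = x' := by
      rw [hx, Gluing.toFun_toFun_inv, Gluing.toFun_inv_toFun]
    have htx : t = boundary x := (H j).injective (by rw [ht, hH, hxx])
    subst htx
    refine GlueRel.glue j x e ?_
    -- The point `f` to which `boundary x` should be glued has the same image as `e`; injectivity of
    -- the exterior map gives `f = e`.
    obtain ⟨f, hf⟩ := exists_exterior_boundary j ((A j).toFun x)
    have hfe : exteriorMap M f = e' := Subtype.ext (by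
      rw [exteriorMap_hopfTube M j _ hf, he', ← Gluing.toFun_comp, ← hC, hx,
        Gluing.toFun_toFun_inv])
    rw [← (exteriorHomeo M).injective (hfe.trans hb'.symm), hf]

/-! ### Orientation in the covering coordinates. -/

theorem hopfCover_mem_exterior : ∀ᶠ x in 𝓝 (0 : Fin 3 → ℝ),
    ∃ e : Exterior hopfTube, e.1 = hopfCover x := by
  have hcont : Continuous fun x : Fin 3 → ℝ => (√(1 + Real.exp (x 2) ^ 2))⁻¹ := by
    refine Continuous.inv₀ (by fun_prop) fun x => ?_
    positivity
  -- At the origin both radii equal 1/√2, strictly above the tube bound 1/2, so nearby points also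
  -- lie in the exterior.
  have h2 : (1 / 2 : ℝ) < (√2)⁻¹ := by
    rw [one_div]
    refine inv_strictAnti₀ (by positivity) ?_
    rw [Real.sqrt_lt' (by norm_num)]
    norm_num
  have h₁ : ∀ᶠ x in 𝓝 (0 : Fin 3 → ℝ), 1 / 2 < (√(1 + Real.exp (x 2) ^ 2))⁻¹ := by
    refine hcont.continuousAt.eventually_const_lt ?_
    norm_num at h2 ⊢
    exact h2
  have h₂ : ∀ᶠ x in 𝓝 (0 : Fin 3 → ℝ),
      1 / 2 < Real.exp (x 2) * (√(1 + Real.exp (x 2) ^ 2))⁻¹ := by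
    have : Continuous fun x : Fin 3 → ℝ => Real.exp (x 2) * (√(1 + Real.exp (x 2) ^ 2))⁻¹ :=
      Continuous.mul (by fun_prop) hcont
    refine this.continuousAt.eventually_const_lt ?_
    norm_num at h2 ⊢
    exact h2
  filter_upwards [h₁, h₂] with x hx₁ hx₂
  refine ⟨⟨hopfCover x, (hopf_exterior_iff _).2 ⟨?_, ?_⟩⟩, rfl⟩
  · simp only [hopfCover, norm_mul, Circle.norm_coe, mul_one, Complex.norm_real, Real.norm_eq_abs]
    exact hx₁.le.trans (le_abs_self _)
  · simp only [hopfCover, norm_mul, Circle.norm_coe, mul_one, Complex.norm_real, Real.norm_eq_abs]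
    rw [← abs_mul]
    exact hx₂.le.trans (le_abs_self _)

/-- The lift of a linear homeomorphism of the exterior to the universal covering. -/
def coverMatrix (M : Gluing) : Matrix (Fin 3) (Fin 3) ℝ :=
  !![(M.y : ℝ), M.q, 0; M.x, M.p, 0; 0, 0, 1]

/-- Powers and products of phases become integer combinations of α and β, while s records the ratio
of the radii and is fixed. The lift is thus linear, and its Jacobian determinant is that of `M`. -/
theorem exteriorMap_hopfCover (M : Gluing) (x : Fin 3 → ℝ) {e : Exterior hopfTube}
    (he : e.1 = hopfCover x) :
    (exteriorMap M e).1 = hopfCover ((coverMatrix M).mulVec x) := by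
  have hpos : (0 : ℝ) < (√(1 + Real.exp (x 2) ^ 2))⁻¹ := by positivity
  have h2 : (coverMatrix M).mulVec x 2 = x 2 := by
    simp [coverMatrix, Matrix.mulVec, dotProduct, Fin.sum_univ_three]
  have h0 : (coverMatrix M).mulVec x 0 = M.y * x 0 + M.q * x 1 := by
    simp [coverMatrix, Matrix.mulVec, dotProduct, Fin.sum_univ_three]
  have h1 : (coverMatrix M).mulVec x 1 = M.x * x 0 + M.p * x 1 := by
    simp [coverMatrix, Matrix.mulVec, dotProduct, Fin.sum_univ_three]
  have hz : ∀ (n : ℤ) (t : ℝ), Circle.exp (n * t) = Circle.exp t ^ n := by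
    intro n t
    rw [← Circle.exp_zsmul]
    simp
  refine exteriorMap_eq hpos (mul_pos (Real.exp_pos (x 2)) hpos)
    (x := (Circle.exp (x 0), Circle.exp (x 1))) (by rw [he]; rfl) ?_
  simp only [hopfCover, h0, h1, h2, Circle.exp_add, hz, Gluing.toFun]

theorem orientedHomeomorphic_of_coeff {A A' : Fin 2 → Gluing} {M : Gluing}
    (hM : M.p * M.y - M.q * M.x = 1)
    (h : ∀ i, ((onTube M i).comp (A i)).coeff = (A' i).coeff) : OrientedHomeomorphic A A' := by
  choose H hH using fun i => exists_torusHomeo (h i)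
  refine ⟨surgeryHomeo (piecesHomeo (exteriorHomeo M) H) (glueRel_iff M H hH), 0,
    (coverMatrix M).mulVec, LinearMap.toContinuousLinearMap (Matrix.toLin' (coverMatrix M)),
    ?_, ?_, ?_⟩
  · exact (LinearMap.toContinuousLinearMap (Matrix.toLin' (coverMatrix M))).hasFDerivAt
  · have : (coverMatrix M).det = 1 := by
      simp [coverMatrix, Matrix.det_fin_three]
      have : ((M.p * M.y - M.q * M.x : ℤ) : ℝ) = 1 := by rw [hM]; simp
      push_cast at this
      linarith
    simp [ContinuousLinearMap.det, this]
  · filter_upwards [hopfCover_mem_exterior] with x hx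
    obtain ⟨e, he⟩ := hx
    exact ⟨e, exteriorMap M e, he, exteriorMap_hopfCover M x he, rfl⟩

theorem SlopesEquiv.sameSurgery {r₁ r₂ r₁' r₂' : OnePoint ℚ} (h : SlopesEquiv r₁ r₂ r₁' r₂') :
    SameSurgery r₁ r₂ r₁' r₂' := by
  obtain ⟨M, hM, h₁, h₂⟩ := h
  intro A A' hA₁ hA₂ hA₁' hA₂'
  refine orientedHomeomorphic_of_coeff hM fun i => ?_
  fin_cases i
  · exact (h₁ _ hA₁).trans hA₁'.symm
  · exact (h₂ _ hA₂).trans hA₂'.symm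

end HopfSurgery

end

/-- Here `a = [a₀, …, aₙ]`, `b = [b₀, …, bₘ]`, `ks = [k₂, …, kₗ]`, so that `l = ks.length + 1`
and `m + 1 = b.length`. -/
theorem proposition3p1 (a b : List ℤ) (ha : a ≠ []) (hb : b ≠ []) (pq rs : OnePoint ℚ)
    (hpq : pq = HopfSurgery.contFrac a)
    (hrs : rs = HopfSurgery.contFrac (b.modifyLast (fun t => t + 1))) :
    (∀ (k₁ : ℤ) (ks : List ℤ),
      HopfSurgery.SameSurgery pq rs
        (HopfSurgery.powSign (HopfSurgery.contFrac ((k₁ :: ks).reverse ++ a)) (ks.length + 1))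
        (HopfSurgery.powSign
          (HopfSurgery.contFrac
            (ks.reverse ++ (b.modifyLast (fun t => t + 1)).modifyHead (fun t => k₁ + t)))
          (ks.length + 2))) ∧
    HopfSurgery.SameSurgery pq rs
      (HopfSurgery.powSign (HopfSurgery.contFrac ((b.map (fun t => -t)).reverse ++ a)) b.length)
      ((1 : ℚ) : OnePoint ℚ) := by
  subst hpq hrs
  have hb' := HopfSurgery.modifyLast_add_one_ne_nil hb
  refine ⟨fun k₁ ks => (HopfSurgery.slopesEquiv_contFrac ha hb' k₁ ks).sameSurgery, ?_⟩
  obtain ⟨c, l, rfl⟩ := List.exists_cons_of_ne_nil hb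
  -- The choice kᵢ = -bᵢ₋₁ with l = m + 1. The second fraction becomes 1, for which the sign of the
  -- exponent is immaterial.
  have h := HopfSurgery.slopesEquiv_contFrac ha hb' (-c) (l.map fun t => -t)
  rw [HopfSurgery.contFrac_cancel, HopfSurgery.powSign_one, List.length_map] at h
  exact h.sameSurgery
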